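/- Let $X$ and $Y$ be complex Banach spaces, let $-A$ be the generator of a bounded strongly continuous semigroup $(T(t))_{t\ge 0}$ on $X$, and assume that $A$ is boundedly invertible, i.e. $0\in\varrho(A)$. Let $C: D(A)\to Y$ be linear and bounded with respect to the graph norm $\|x\|+\|Ax\|$ on $D(A)$. For $\alpha>0$ let $A^{-\alpha}$ denote the (bounded) fractional power of $A$, that is $$A^{-\alpha}x=\frac{\sin \pi\alpha}{\pi}\int_0^\infty t^{-\alpha}(t+A)^{-1}x\,dt\qquad(0<\alpha<1),$$ and $A^{-(n+s)}=(A^{-1})^nA^{-s}$ for $n\in\mathbb N$, $0\le s<1$ (with $A^{0}=I$); it maps $D(A)$ into $D(A)$. If there are $\varepsilon,\delta>0$ such that $$\|CA^{-\frac12-\varepsilon}x\|_Y\ \ge\ \delta\,\|x\|\qquad\text{for all } x\in D(A),$$ then $C$ is infinite-time exactly observable for $A$: there is a constant $m>0$ such that $$m^2\|x\|^2\ \le\ \int_0^\infty\|CT(t)x\|_Y^2\,dt\qquad\text{for all } x\in D(A),$$ where the right-hand side may be $+\infty$. -/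

import Mathlib

open Filter Topology MeasureTheory Set
open scoped NNReal ENNReal

/-- A strongly continuous one-parameter semigroup of bounded operators on `X`. -/
structure C0Semigroup (X : Type*) [NormedAddCommGroup X] [NormedSpace ℂ X] where
  toFun : ℝ≥0 → X →L[ℂ] X
  map_zero : toFun 0 = ContinuousLinearMap.id ℂ X
  map_add : ∀ s t : ℝ≥0, toFun (s + t) = (toFun s).comp (toFun t)
  continuous_orbit : ∀ x : X, Continuous fun t : ℝ≥0 => toFun t x

namespace C0Semigroup

variable {X : Type*} [NormedAddCommGroup X] [NormedSpace ℂ X]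

/-- The semigroup is uniformly bounded: `sup_{t ≥ 0} ‖T t‖ < ∞`. -/
def IsBounded (T : C0Semigroup X) : Prop :=
  ∃ M : ℝ, ∀ t : ℝ≥0, ‖T.toFun t‖ ≤ M

/-- The unbounded operator `B` is the (infinitesimal) generator of `T`: its graph consists exactly
of the pairs `(x, y)` with `y = lim_{t → 0+} (T t x - x) / t`. In particular the domain of `B` is
the set of all `x` for which this limit exists. -/
def IsGenerator (T : C0Semigroup X) (B : X →ₗ.[ℂ] X) : Prop :=
  ∀ x y : X, (x, y) ∈ B.graph ↔
    Tendsto (fun t : ℝ≥0 => (t : ℝ)⁻¹ • (T.toFun t x - x)) (𝓝[>] 0) (𝓝 y)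

theorem IsGenerator.map_mem_domain {T : C0Semigroup X} {A : X →ₗ.[ℂ] X}
    (hA : T.IsGenerator (-A)) (t : ℝ≥0) (x : A.domain) : T.toFun t (x : X) ∈ A.domain := by
  have h1 : ((x : X), (-A) x) ∈ (-A).graph := (-A).mem_graph x
  have h2 := ((T.toFun t).continuous.tendsto _).comp ((hA _ _).1 h1)
  have h3 : (T.toFun t (x : X), T.toFun t ((-A) x)) ∈ (-A).graph := by
    refine (hA _ _).2 (h2.congr fun s => ?_)
    have h4 : T.toFun t (T.toFun s (x : X)) = T.toFun s (T.toFun t (x : X)) := by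
      have h5 := T.map_add t s
      rw [add_comm, T.map_add s t] at h5
      exact (DFunLike.congr_fun h5 (x : X)).symm
    have h6 : ∀ (r : ℝ) (z : X), T.toFun t (r • z) = r • T.toFun t z := fun r z =>
      ((T.toFun t).restrictScalars ℝ).map_smul r z
    simp only [Function.comp_apply, h6, map_sub, h4]
  have h7 : T.toFun t (x : X) ∈ (-A).domain := LinearPMap.mem_domain_of_mem_graph h3
  exact h7

/-- If `-A` generates `T`, each `T t` maps the domain of `A` into itself; this is the resulting
element of the domain. -/
def onDomain {T : C0Semigroup X} {A : X →ₗ.[ℂ] X} (hA : T.IsGenerator (-A)) (t : ℝ≥0)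
    (x : A.domain) : A.domain :=
  ⟨T.toFun t (x : X), hA.map_mem_domain t x⟩

end C0Semigroup

section Operators

variable {X : Type*} [NormedAddCommGroup X] [NormedSpace ℂ X]

/-- `R` is a bounded, everywhere defined, two-sided inverse of the unbounded operator `B`. -/
def IsBoundedInverse (B : X →ₗ.[ℂ] X) (R : X →L[ℂ] X) : Prop :=
  (∀ x : B.domain, R (B x) = x) ∧ ∀ y : X, ∃ h : R y ∈ B.domain, B ⟨R y, h⟩ = y

/-- `B` is boundedly invertible, i.e. `0` lies in its resolvent set. -/
def IsBoundedlyInvertible (B : X →ₗ.[ℂ] X) : Prop :=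
  ∃ R : X →L[ℂ] X, IsBoundedInverse B R

open Classical in
/-- The bounded inverse of `B` (which is unique); `0` if `B` is not boundedly invertible. -/
noncomputable def boundedInverse (B : X →ₗ.[ℂ] X) : X →L[ℂ] X :=
  if h : IsBoundedlyInvertible B then h.choose else 0

/-- The operator `t + A` with domain that of `A`. -/
noncomputable def shift (A : X →ₗ.[ℂ] X) (t : ℝ) : X →ₗ.[ℂ] X :=
  ((t : ℂ) • (LinearMap.id : X →ₗ[ℂ] X)) +ᵥ A

/-- Balakrishnan's formula for `A^{-s} x`, where `0 < s < 1`: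
`A^{-s} x = (sin (π s) / π) ∫_0^∞ t^{-s} (t + A)⁻¹ x dt`. -/
noncomputable def balakrishnan (A : X →ₗ.[ℂ] X) (s : ℝ) (x : X) : X :=
  (Real.sin (Real.pi * s) / Real.pi) •
    ∫ t in Ioi (0 : ℝ), (t ^ (-s)) • boundedInverse (shift A t) x

open Classical in
/-- The fractional power `A^{-α} x`, `α ≥ 0`, of a boundedly invertible operator `A` such that `-A`
generates a bounded semigroup: `A^{-α} = (A⁻¹)^n A^{-s}` where `α = n + s` with `n ∈ ℕ` and
`s ∈ [0, 1)`, and `A^{-s}` is the identity for `s = 0` and given by Balakrishnan's formula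
for `0 < s < 1`. -/
noncomputable def negPow (A : X →ₗ.[ℂ] X) (α : ℝ) (x : X) : X :=
  (boundedInverse A ^ ⌊α⌋₊) (if Int.fract α = 0 then x else balakrishnan A (Int.fract α) x)

variable {Y : Type*} [NormedAddCommGroup Y] [NormedSpace ℂ Y]

/-- `C : D(A) → Y` is bounded with respect to the graph norm `‖x‖ + ‖A x‖`. -/
def IsGraphBounded (A : X →ₗ.[ℂ] X) (C : A.domain →ₗ[ℂ] Y) : Prop :=
  ∃ K : ℝ, ∀ x : A.domain, ‖C x‖ ≤ K * (‖(x : X)‖ + ‖A x‖)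

/-- Infinite-time exact (`L²`-)observability: there is `m > 0` with
`m² ‖x‖² ≤ ∫_0^∞ ‖C T(t) x‖² dt` (possibly `= ∞`) for all `x ∈ D(A)`. -/
def IsInfiniteTimeExactlyObservable {T : C0Semigroup X} {A : X →ₗ.[ℂ] X}
    (hA : T.IsGenerator (-A)) (C : A.domain →ₗ[ℂ] Y) : Prop :=
  ∃ m : ℝ, 0 < m ∧ ∀ x : A.domain,
    ENNReal.ofReal (m ^ 2 * ‖(x : X)‖ ^ 2) ≤
      ∫⁻ t in Ioi (0 : ℝ), ‖C (C0Semigroup.onDomain hA t.toNNReal x)‖ₑ ^ 2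

end Operators

/-!
Write `P = (1 + A)⁻¹` and `Q = 1 - P = A (1 + A)⁻¹`, let `F = C A⁻¹`, which is bounded, and let
`N w` be the `L²`-norm of the output `t ↦ F T(t) w`. Since `(r + A)⁻¹` is the Laplace transform of
the semigroup, the Cauchy-Schwarz inequality gives `‖F (r + A)⁻¹ w‖ ≤ r ^ (-1/2) N w`. Inserted into
Balakrishnan's integral for `A ^ (-s)`, this bound is integrable at infinity for `s > 1/2`, but not
at zero; the factor `Q` in `F (r + A)⁻¹ Q w` makes the integrand bounded at zero, and a further
factor `P` improves the decay at infinity to `r⁻¹`, which suffices for all `s > 0`. Integer powers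
are absorbed by `A ^ (-k) Q ^ (k + 1) = Q P ^ k`. Hence, with `α = 1/2 + ε` and `n = ⌊α⌋ + 1`,
`‖F A ^ (-α) Q ^ n w‖ ≤ K N w`. Now take `w = A x` and apply the lower bound for `C A ^ (-α)` at
`Q ^ n x`: this bounds `Q ^ n x`, and therefore `x`, because `Q` is boundedly invertible with
inverse `1 + A⁻¹`.
-/

section Ring

variable {R : Type*} [Ring R] {a p : R}

theorem mul_one_sub_of_sub_eq_mul (h : a - p = a * p) : a * (1 - p) = p := by
  rw [mul_sub, mul_one, ← h, sub_sub_cancel]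

theorem one_add_mul_one_sub_of_sub_eq_mul (h : a - p = a * p) : (1 + a) * (1 - p) = 1 := by
  rw [add_mul, one_mul, mul_one_sub_of_sub_eq_mul h, sub_add_cancel]

theorem pow_mul_one_sub_pow_succ_of_sub_eq_mul (h : a - p = a * p) (hcomm : Commute a p) (k : ℕ) :
    a ^ k * (1 - p) ^ (k + 1) = (1 - p) * p ^ k := by
  have ha : Commute a (1 - p) := (Commute.one_right a).sub_right hcomm
  have hp : Commute p (1 - p) := (Commute.one_right p).sub_right (Commute.refl p)
  rw [pow_succ, ← mul_assoc, ← ha.mul_pow, mul_one_sub_of_sub_eq_mul h, (hp.pow_left k).eq]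

end Ring

section Graph

variable {X : Type*} [NormedAddCommGroup X] [NormedSpace ℂ X] {A B : X →ₗ.[ℂ] X}
  {R S : X →L[ℂ] X} {r q : ℝ} {x y : X}

/-- The operator `(r + A)⁻¹`, that is, the resolvent of `-A` at `r`; as for `boundedInverse`, it
is `0` unless `r + A` is boundedly invertible. -/
noncomputable abbrev shiftInverse (A : X →ₗ.[ℂ] X) (r : ℝ) : X →L[ℂ] X :=
  boundedInverse (shift A r)

/-- The Yosida approximation `A (1 + A)⁻¹` of `A`, written as the everywhere defined operator
`1 - (1 + A)⁻¹`. -/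
noncomputable def yosida (A : X →ₗ.[ℂ] X) : X →L[ℂ] X :=
  1 - shiftInverse A 1

theorem commute_yosida_shiftInverse_one (A : X →ₗ.[ℂ] X) :
    Commute (yosida A) (shiftInverse A 1) :=
  (Commute.one_left _).sub_left (Commute.refl _)

theorem mem_graph_neg_iff : (x, y) ∈ (-A).graph ↔ (x, -y) ∈ A.graph := by
  simp only [LinearPMap.mem_graph_iff, LinearPMap.neg_apply, LinearPMap.neg_domain,
    neg_eq_iff_eq_neg]

theorem shift_zero : shift A 0 = A := by
  simp [shift]

theorem mem_graph_shift_iff :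
    (x, y) ∈ (shift A r).graph ↔ (x, y - (r : ℂ) • x) ∈ A.graph := by
  simp only [LinearPMap.mem_graph_iff, eq_sub_iff_add_eq']
  refine exists_congr fun z => and_congr_right fun hz => ?_
  subst hz
  rfl

theorem isBoundedInverse_iff_mem_graph_iff :
    IsBoundedInverse B R ↔ ∀ x y, (x, y) ∈ B.graph ↔ R y = x := by
  constructor
  · rintro ⟨hleft, hright⟩ x y
    refine ⟨fun h => ?_, fun h => ?_⟩
    · obtain ⟨z, rfl, rfl⟩ := B.mem_graph_iff.1 h
      exact hleft z
    · obtain ⟨hy, hBy⟩ := hright y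
      exact B.mem_graph_iff.2 ⟨⟨R y, hy⟩, h, hBy⟩
  · intro h
    refine ⟨fun x => (h _ _).1 (B.mem_graph x), fun y => ?_⟩
    have hy : (R y, y) ∈ B.graph := (h _ _).2 rfl
    obtain ⟨z, hz, hBz⟩ := B.mem_graph_iff.1 hy
    exact ⟨LinearPMap.mem_domain_of_mem_graph hy, (congrArg B (Subtype.ext hz.symm)).trans hBz⟩

theorem IsBoundedlyInvertible.isBoundedInverse (h : IsBoundedlyInvertible B) :
    IsBoundedInverse B (boundedInverse B) := by
  rw [boundedInverse, dif_pos h]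
  exact h.choose_spec

namespace IsBoundedInverse

theorem mem_graph_iff (hR : IsBoundedInverse B R) : (x, y) ∈ B.graph ↔ R y = x :=
  isBoundedInverse_iff_mem_graph_iff.1 hR x y

theorem unique (hR : IsBoundedInverse B R) (hS : IsBoundedInverse B S) : R = S :=
  ContinuousLinearMap.ext fun _ => hR.mem_graph_iff.1 (hS.mem_graph_iff.2 rfl)

theorem boundedInverse_eq (hR : IsBoundedInverse B R) : boundedInverse B = R :=
  (IsBoundedlyInvertible.isBoundedInverse ⟨R, hR⟩).unique hR

theorem commute_iff_map_mem_graph (hR : IsBoundedInverse (shift A r) R) :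
    Commute R S ↔ ∀ x y, (x, y) ∈ A.graph → (S x, S y) ∈ A.graph := by
  have hgraph : ∀ x y, (x, y) ∈ A.graph ↔ R (y + (r : ℂ) • x) = x := fun x y => by
    rw [← hR.mem_graph_iff, mem_graph_shift_iff, add_sub_cancel_right]
  refine ⟨fun hcomm x y hxy => ?_, fun hS => ContinuousLinearMap.ext fun y => ?_⟩
  · rw [hgraph] at hxy ⊢
    rw [← map_smul, ← map_add, ← mul_apply_eq_comp, hcomm.eq,
      mul_apply_eq_comp, hxy]
  · have h := hS (R y) (y - (r : ℂ) • R y) ((hgraph _ _).2 (by rw [sub_add_cancel]))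
    rwa [hgraph, map_sub, map_smul, sub_add_cancel] at h

theorem commute (hR : IsBoundedInverse (shift A r) R) (hS : IsBoundedInverse (shift A q) S) :
    Commute R S :=
  hR.commute_iff_map_mem_graph.2 (hS.commute_iff_map_mem_graph.1 (Commute.refl S))

theorem sub_eq_smul_mul (hR : IsBoundedInverse (shift A r) R)
    (hS : IsBoundedInverse (shift A q) S) : R - S = (q - r) • (R * S) := by
  ext y
  have hgraph : (S y, y - (q - r) • S y) ∈ (shift A r).graph := by
    have hy := mem_graph_shift_iff.1 (hS.mem_graph_iff.2 (rfl : S y = S y))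
    rw [mem_graph_shift_iff]
    convert hy using 2
    simp only [← Complex.coe_smul]
    module
  have h := hR.mem_graph_iff.1 hgraph
  rw [map_sub, ContinuousLinearMap.map_smul_of_tower] at h
  exact sub_eq_iff_eq_add'.2 (sub_eq_iff_eq_add.1 h)

end IsBoundedInverse

theorem IsBoundedlyInvertible.isBoundedInverse_shift_zero (hinv : IsBoundedlyInvertible A) :
    IsBoundedInverse (shift A 0) (boundedInverse A) := by
  rw [shift_zero]
  exact hinv.isBoundedInverse

end Graph

namespace C0Semigroup

section Laplace

variable {X : Type*} [NormedAddCommGroup X] [NormedSpace ℂ X] (T : C0Semigroup X)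

/-- The operator `T t` as a function of a real time `t`; it is the identity for `t ≤ 0`. -/
def op (t : ℝ) : X →L[ℂ] X :=
  T.toFun t.toNNReal

theorem op_coe (t : ℝ≥0) : T.op t = T.toFun t := by
  rw [op, Real.toNNReal_coe]

theorem op_zero : T.op 0 = 1 := by
  rw [op, Real.toNNReal_zero, T.map_zero]
  rfl

theorem op_op {s t : ℝ} (hs : 0 ≤ s) (ht : 0 ≤ t) (w : X) :
    T.op s (T.op t w) = T.op (s + t) w := by
  rw [op, op, op, Real.toNNReal_add hs ht, T.map_add, ContinuousLinearMap.comp_apply]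

theorem commute_op (s t : ℝ) : Commute (T.op s) (T.op t) :=
  (T.map_add _ _).symm.trans ((congrArg T.toFun (add_comm _ _)).trans (T.map_add _ _))

theorem continuous_op_apply (w : X) : Continuous fun t => T.op t w :=
  (T.continuous_orbit w).comp continuous_real_toNNReal

theorem continuous_exp_smul_op (w : X) :
    Continuous fun p : ℝ × ℝ => Real.exp (-p.1 * p.2) • T.op p.2 w :=
  (by fun_prop : Continuous fun p : ℝ × ℝ => Real.exp (-p.1 * p.2)).smul
    ((T.continuous_op_apply w).comp continuous_snd)

variable {T} {B : X →ₗ.[ℂ] X} {M r : ℝ}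

theorem norm_exp_smul_op_le (hM : ∀ t, ‖T.toFun t‖ ≤ M) (t : ℝ) (w : X) :
    ‖Real.exp (-r * t) • T.op t w‖ ≤ Real.exp (-r * t) * (M * ‖w‖) := by
  rw [norm_smul, Real.norm_of_nonneg (Real.exp_nonneg _)]
  gcongr
  exact (T.op t).le_of_opNorm_le (hM _) w

theorem IsBounded.integrableOn_exp_smul_op (hT : T.IsBounded) (hr : 0 < r) (w : X) :
    IntegrableOn (fun t : ℝ => Real.exp (-r * t) • T.op t w) (Ioi 0) := by
  obtain ⟨M, hM⟩ := hT
  exact ((integrableOn_exp_mul_Ioi (neg_lt_zero.2 hr) 0).mul_const (M * ‖w‖)).mono'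
    ((T.continuous_exp_smul_op w).comp (Continuous.prodMk_right r)).aestronglyMeasurable
    (ae_of_all _ fun t => norm_exp_smul_op_le hM t w)

theorem norm_integral_exp_smul_op_le (hM : ∀ t, ‖T.toFun t‖ ≤ M) (hr : 0 < r) (w : X) :
    ‖∫ t in Ioi (0 : ℝ), Real.exp (-r * t) • T.op t w‖ ≤ M / r * ‖w‖ := by
  have hexp := integrableOn_exp_mul_Ioi (neg_lt_zero.2 hr) 0
  calc ‖∫ t in Ioi (0 : ℝ), Real.exp (-r * t) • T.op t w‖
      ≤ ∫ t in Ioi (0 : ℝ), Real.exp (-r * t) * (M * ‖w‖) :=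
        norm_integral_le_of_norm_le (hexp.mul_const _)
          (ae_of_all _ fun t => norm_exp_smul_op_le hM t w)
    _ = M / r * ‖w‖ := by
        rw [integral_mul_const, integral_exp_mul_Ioi (neg_lt_zero.2 hr), mul_zero, Real.exp_zero,
          neg_div_neg_eq]
        ring

/-- The Laplace transform `w ↦ ∫_0^∞ e^{-rt} T(t) w dt` of a bounded semigroup, at `r > 0`. -/
noncomputable def IsBounded.laplace (hT : T.IsBounded) (hr : 0 < r) : X →L[ℂ] X :=
  LinearMap.mkContinuousOfExistsBound
    { toFun := fun w => ∫ t in Ioi (0 : ℝ), Real.exp (-r * t) • T.op t w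
      map_add' := fun v w => by
        simp only [_root_.map_add, smul_add]
        exact integral_add (hT.integrableOn_exp_smul_op hr v) (hT.integrableOn_exp_smul_op hr w)
      map_smul' := fun c w => by
        simp only [map_smul, RingHom.id_apply, smul_comm _ c, integral_smul] }
    (hT.imp' (· / r) fun _ hM w => norm_integral_exp_smul_op_le hM hr w)

theorem IsBounded.laplace_apply (hT : T.IsBounded) (hr : 0 < r) (w : X) :
    hT.laplace hr w = ∫ t in Ioi (0 : ℝ), Real.exp (-r * t) • T.op t w :=
  rfl

theorem IsBounded.norm_laplace_le (hT : T.IsBounded) (hM : ∀ t, ‖T.toFun t‖ ≤ M) (hr : 0 < r) :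
    ‖hT.laplace hr‖ ≤ M / r :=
  have hM0 : 0 ≤ M := (norm_nonneg _).trans (hM 0)
  ContinuousLinearMap.opNorm_le_bound _ (by positivity) (norm_integral_exp_smul_op_le hM hr)

section Complete

variable [CompleteSpace X]

theorem IsBounded.commute_op_laplace (hT : T.IsBounded) (hr : 0 < r) (s : ℝ) :
    Commute (T.op s) (hT.laplace hr) := by
  ext w
  simp only [mul_apply_eq_comp, hT.laplace_apply, ← ContinuousLinearMap.integral_comp_comm _
    (hT.integrableOn_exp_smul_op hr w), ContinuousLinearMap.map_smul_of_tower]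
  exact integral_congr_ae (ae_of_all _ fun t =>
    congrArg _ (DFunLike.congr_fun (T.commute_op s t).eq w))

theorem IsBounded.op_laplace (hT : T.IsBounded) (hr : 0 < r) {h : ℝ} (hh : 0 ≤ h) (w : X) :
    T.op h (hT.laplace hr w) = Real.exp (r * h) •
      (hT.laplace hr w - ∫ t in (0 : ℝ)..h, Real.exp (-r * t) • T.op t w) := by
  have hint := hT.integrableOn_exp_smul_op hr w
  have htail : hT.laplace hr w - ∫ t in (0 : ℝ)..h, Real.exp (-r * t) • T.op t w =
      ∫ t in Ioi h, Real.exp (-r * t) • T.op t w := by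
    rw [sub_eq_iff_eq_add', hT.laplace_apply, intervalIntegral.integral_interval_add_Ioi hint
      (hint.mono_set (Ioi_subset_Ioi hh))]
  rw [htail, hT.laplace_apply, ← ContinuousLinearMap.integral_comp_comm _ hint, ← integral_smul,
    ← (measurePreserving_add_left volume h).setIntegral_preimage_emb
      (measurableEmbedding_addLeft h) _ (Ioi h), preimage_const_add_Ioi, sub_self]
  refine setIntegral_congr_fun measurableSet_Ioi fun t (ht : 0 < t) => ?_
  simp only [ContinuousLinearMap.map_smul_of_tower, T.op_op hh ht.le, smul_smul, ← Real.exp_add]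
  ring_nf

theorem hasDerivAt_exp_smul_sub_integral (T : C0Semigroup X) (r : ℝ) (v w : X) :
    HasDerivAt (fun h => Real.exp (r * h) •
      (v - ∫ t in (0 : ℝ)..h, Real.exp (-r * t) • T.op t w)) (r • v - w) 0 := by
  have hcont : Continuous fun t => Real.exp (-r * t) • T.op t w :=
    (T.continuous_exp_smul_op w).comp (Continuous.prodMk_right r)
  have hintegral : HasDerivAt (fun h => ∫ t in (0 : ℝ)..h, Real.exp (-r * t) • T.op t w)
      (Real.exp (-r * 0) • T.op 0 w) 0 :=
    intervalIntegral.integral_hasDerivAt_right (hcont.intervalIntegrable _ _)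
      (hcont.stronglyMeasurableAtFilter _ _) hcont.continuousAt
  have hexp : HasDerivAt (fun h => Real.exp (r * h)) (Real.exp (r * 0) * (r * 1)) 0 :=
    ((hasDerivAt_id (0 : ℝ)).const_mul r).exp
  exact (hexp.smul (hintegral.const_sub v)).congr_deriv (by simp [T.op_zero, neg_add_eq_sub])

end Complete

namespace IsGenerator

theorem mem_graph_of_hasDerivWithinAt (hB : T.IsGenerator B) {x y : X}
    (h : HasDerivWithinAt (fun t => T.op t x) y (Ioi 0) 0) : (x, y) ∈ B.graph := by
  have hcoe : Tendsto ((↑) : ℝ≥0 → ℝ) (𝓝[>] 0) (𝓝[>] 0) :=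
    NNReal.continuous_coe.continuousWithinAt.tendsto_nhdsWithin fun t (ht : 0 < t) => ht
  refine (hB x y).2 ((((hasDerivWithinAt_iff_tendsto_slope'
    self_notMem_Ioi).1 h).comp hcoe).congr fun t => ?_)
  simp only [Function.comp_apply, slope_def_module, op_coe, op_zero, sub_zero,
    one_apply_eq_self]

theorem map_mem_graph (hB : T.IsGenerator B) {S : X →L[ℂ] X} (hS : ∀ t, Commute S (T.toFun t))
    {x y : X} (hxy : (x, y) ∈ B.graph) : (S x, S y) ∈ B.graph := by
  refine (hB _ _).2 (((S.continuous.tendsto y).comp ((hB x y).1 hxy)).congr fun t => ?_)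
  rw [Function.comp_apply, ContinuousLinearMap.map_smul_of_tower, map_sub,
    ← mul_apply_eq_comp, (hS t).eq, mul_apply_eq_comp]

variable [CompleteSpace X]

theorem laplace_mem_graph (hB : T.IsGenerator B) (hT : T.IsBounded) (hr : 0 < r) (w : X) :
    (hT.laplace hr w, r • hT.laplace hr w - w) ∈ B.graph := by
  refine hB.mem_graph_of_hasDerivWithinAt
    ((T.hasDerivAt_exp_smul_sub_integral r _ w).hasDerivWithinAt.congr
      (fun h hh => hT.op_laplace hr (le_of_lt hh) w) (hT.op_laplace hr le_rfl w))

variable {A : X →ₗ.[ℂ] X}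

theorem isBoundedInverse_laplace (hA : T.IsGenerator (-A)) (hT : T.IsBounded) (hr : 0 < r) :
    IsBoundedInverse (shift A r) (hT.laplace hr) := by
  refine isBoundedInverse_iff_mem_graph_iff.2 fun x y => ?_
  rw [mem_graph_shift_iff, ← neg_neg (y - _), ← mem_graph_neg_iff, neg_sub]
  refine ⟨fun hxy => ?_, ?_⟩
  · have hcomm : ∀ t, Commute (hT.laplace hr) (T.toFun t) := fun t =>
      T.op_coe t ▸ (hT.commute_op_laplace hr t).symm
    have huniq := LinearPMap.mem_graph_snd_inj _ (hA.map_mem_graph hcomm hxy)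
      (hA.laplace_mem_graph hT hr x) rfl
    rw [map_sub, map_smul, Complex.coe_smul] at huniq
    exact sub_right_injective huniq
  · rintro rfl
    exact hA.laplace_mem_graph hT hr y

theorem shiftInverse_eq_laplace (hA : T.IsGenerator (-A)) (hT : T.IsBounded) (hr : 0 < r) :
    shiftInverse A r = hT.laplace hr :=
  (hA.isBoundedInverse_laplace hT hr).boundedInverse_eq

theorem isBoundedInverse_shiftInverse (hA : T.IsGenerator (-A)) (hT : T.IsBounded) (hr : 0 < r) :
    IsBoundedInverse (shift A r) (shiftInverse A r) :=
  hA.shiftInverse_eq_laplace hT hr ▸ hA.isBoundedInverse_laplace hT hr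

end IsGenerator

end Laplace

end C0Semigroup

section Lintegral

theorem sq_lintegral_mul_le {α : Type*} [MeasurableSpace α] {μ : Measure α} {k g : α → ℝ≥0∞}
    (hk : AEMeasurable k μ) (hg : AEMeasurable g μ) :
    (∫⁻ a, k a * g a ∂μ) ^ 2 ≤ (∫⁻ a, k a ∂μ) * ∫⁻ a, k a * g a ^ 2 ∂μ := by
  have hsplit : ∀ c d : ℝ≥0∞, c ^ (1 / 2 : ℝ) * (c * d ^ 2) ^ (1 / 2 : ℝ) = c * d := fun c d => by
    rw [← ENNReal.mul_rpow_of_nonneg _ _ (by norm_num), ← mul_assoc, ← sq, ← mul_pow,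
      ← ENNReal.rpow_natCast, ← ENNReal.rpow_mul]
    norm_num
  have hholder := ENNReal.lintegral_mul_norm_pow_le hk (hk.mul (hg.pow_const 2))
    (p := 1 / 2) (q := 1 / 2) (by norm_num) (by norm_num) (by norm_num)
  simp only [Pi.mul_apply, hsplit] at hholder
  refine (pow_le_pow_left' hholder 2).trans_eq ?_
  rw [← ENNReal.mul_rpow_of_nonneg _ _ (by norm_num), ← ENNReal.rpow_natCast, ← ENNReal.rpow_mul]
  norm_num

theorem setLIntegral_Ioi_comp_add_right_le (f : ℝ → ℝ≥0∞) {u : ℝ} (hu : 0 ≤ u) :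
    ∫⁻ t in Ioi 0, f (t + u) ≤ ∫⁻ t in Ioi 0, f t := by
  have hshift := (measurePreserving_add_right volume u).setLIntegral_comp_preimage_emb
    (measurableEmbedding_addRight u) f (Ioi u)
  rw [preimage_add_const_Ioi, sub_self] at hshift
  exact hshift.trans_le (lintegral_mono_set (Ioi_subset_Ioi hu))

/-- Young's inequality `L¹ * L² ⊆ L²` on the half-line. -/
theorem lintegral_sq_lintegral_mul_comp_add_le {k g : ℝ → ℝ≥0∞} (hk : Measurable k)
    (hg : Measurable g) :
    ∫⁻ t in Ioi 0, (∫⁻ u in Ioi 0, k u * g (t + u)) ^ 2 ≤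
      (∫⁻ u in Ioi 0, k u) ^ 2 * ∫⁻ t in Ioi 0, g t ^ 2 := by
  have hint : Measurable fun p : ℝ × ℝ => k p.2 * g (p.1 + p.2) ^ 2 := by fun_prop
  calc ∫⁻ t in Ioi 0, (∫⁻ u in Ioi 0, k u * g (t + u)) ^ 2
      ≤ ∫⁻ t in Ioi 0, (∫⁻ u in Ioi 0, k u) * ∫⁻ u in Ioi 0, k u * g (t + u) ^ 2 :=
        lintegral_mono fun t => sq_lintegral_mul_le hk.aemeasurable (by fun_prop)
    _ = (∫⁻ u in Ioi 0, k u) * ∫⁻ u in Ioi 0, ∫⁻ t in Ioi 0, k u * g (t + u) ^ 2 := by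
        rw [lintegral_const_mul _ hint.lintegral_prod_right',
          lintegral_lintegral_swap hint.aemeasurable]
    _ ≤ (∫⁻ u in Ioi 0, k u) * ∫⁻ u in Ioi 0, k u * ∫⁻ t in Ioi 0, g t ^ 2 := by
        gcongr _ * ?_
        refine setLIntegral_mono' measurableSet_Ioi fun u (hu : 0 < u) => ?_
        rw [lintegral_const_mul _ (by fun_prop)]
        gcongr _ * ?_
        exact setLIntegral_Ioi_comp_add_right_le (fun t => g t ^ 2) hu.le
    _ = (∫⁻ u in Ioi 0, k u) ^ 2 * ∫⁻ t in Ioi 0, g t ^ 2 := by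
        rw [lintegral_mul_const _ hk, sq, mul_assoc]

theorem lintegral_ofReal_exp_neg_mul_Ioi {r : ℝ} (hr : 0 < r) :
    ∫⁻ t in Ioi 0, ENNReal.ofReal (Real.exp (-r * t)) = ENNReal.ofReal r⁻¹ := by
  rw [← ofReal_integral_eq_lintegral_ofReal (integrableOn_exp_mul_Ioi (neg_lt_zero.2 hr) 0)
    (ae_of_all _ fun _ => Real.exp_nonneg _), integral_exp_mul_Ioi (neg_lt_zero.2 hr)]
  simp

theorem exists_lintegral_rpow_mul_le {s β : ℝ} (hs : s < 1) (hβ : 1 < s + β) :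
    ∃ K : ℝ≥0, ∀ (g : ℝ → ℝ≥0∞) (c : ℝ≥0∞), (∀ r > 0, g r ≤ c) →
      (∀ r > 0, g r ≤ ENNReal.ofReal (r ^ (-β)) * c) →
      ∫⁻ r in Ioi 0, ENNReal.ofReal (r ^ (-s)) * g r ≤ K * c := by
  have hzero : IntegrableOn (fun r : ℝ => r ^ (-s)) (Ioc 0 1) :=
    (intervalIntegrable_iff_integrableOn_Ioc_of_le zero_le_one).1
      (intervalIntegral.intervalIntegrable_rpow' (by linarith))
  have hinfty : IntegrableOn (fun r : ℝ => r ^ (-(s + β))) (Ioi 1) :=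
    integrableOn_Ioi_rpow_of_lt (by linarith) one_pos
  refine ⟨(∫⁻ r in Ioc (0 : ℝ) 1, ENNReal.ofReal (r ^ (-s))).toNNReal +
    (∫⁻ r in Ioi (1 : ℝ), ENNReal.ofReal (r ^ (-(s + β)))).toNNReal, fun g c hbound hdecay => ?_⟩
  rw [ENNReal.coe_add, ENNReal.coe_toNNReal hzero.lintegral_lt_top.ne,
    ENNReal.coe_toNNReal hinfty.lintegral_lt_top.ne, add_mul,
    ← lintegral_mul_const _ (by fun_prop), ← lintegral_mul_const _ (by fun_prop),
    ← Ioc_union_Ioi_eq_Ioi zero_le_one]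
  refine (lintegral_union_le _ _ _).trans (add_le_add
    (setLIntegral_mono' measurableSet_Ioc fun r hr => ?_)
    (setLIntegral_mono' measurableSet_Ioi fun r (hr : 1 < r) => ?_))
  · gcongr
    exact hbound r hr.1
  · have hr0 : 0 < r := one_pos.trans hr
    rw [neg_add, Real.rpow_add hr0, ENNReal.ofReal_mul (by positivity), mul_assoc]
    gcongr
    exact hdecay r hr0

end Lintegral

section Bochner

variable {α 𝕜 X Y : Type*} [MeasurableSpace α] {μ : Measure α} [RCLike 𝕜]
  [NormedAddCommGroup X] [NormedSpace ℝ X] [NormedSpace 𝕜 X] [CompleteSpace X]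
  [NormedAddCommGroup Y] [NormedSpace ℝ Y] [NormedSpace 𝕜 Y] [CompleteSpace Y]

theorem enorm_map_integral_le (F : X →L[𝕜] Y) {f : α → X} (hf : Integrable f μ) :
    ‖F (∫ a, f a ∂μ)‖ₑ ≤ ∫⁻ a, ‖F (f a)‖ₑ ∂μ := by
  rw [← F.integral_comp_comm hf]
  exact enorm_integral_le_lintegral_enorm _

end Bochner

namespace C0Semigroup

section Output

variable {X Y : Type*} [NormedAddCommGroup X] [NormedSpace ℂ X] [NormedAddCommGroup Y]
  [NormedSpace ℂ Y] {T : C0Semigroup X} {r : ℝ}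

/-- The `L²`-norm over `(0, ∞)`, possibly infinite, of the output `t ↦ F (T t w)` of the orbit of
`w` under a bounded observation operator `F`. -/
noncomputable def outputNorm (T : C0Semigroup X) (F : X →L[ℂ] Y) (w : X) : ℝ≥0∞ :=
  eLpNorm (fun t => F (T.op t w)) 2 (volume.restrict (Ioi 0))

theorem sq_outputNorm (T : C0Semigroup X) (F : X →L[ℂ] Y) (w : X) :
    T.outputNorm F w ^ 2 = ∫⁻ t in Ioi 0, ‖F (T.op t w)‖ₑ ^ 2 := by
  simpa only [outputNorm, NNReal.coe_ofNat, ENNReal.coe_ofNat, ENNReal.rpow_ofNat] using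
    eLpNorm_nnreal_pow_eq_lintegral (f := fun t => F (T.op t w)) (μ := volume.restrict (Ioi 0))
      (two_ne_zero (α := ℝ≥0))

theorem continuous_map_op_apply (T : C0Semigroup X) (F : X →L[ℂ] Y) (w : X) :
    Continuous fun t => F (T.op t w) :=
  F.continuous.comp (T.continuous_op_apply w)

theorem outputNorm_sub_le (T : C0Semigroup X) (F : X →L[ℂ] Y) (v w : X) :
    T.outputNorm F (v - w) ≤ T.outputNorm F v + T.outputNorm F w := by
  simp only [outputNorm, map_sub]
  exact eLpNorm_sub_le (T.continuous_map_op_apply F v).aestronglyMeasurable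
    (T.continuous_map_op_apply F w).aestronglyMeasurable one_le_two

variable [CompleteSpace X] [CompleteSpace Y]

theorem IsBounded.enorm_map_laplace_le (hT : T.IsBounded) (hr : 0 < r) (F : X →L[ℂ] Y) (w : X) :
    ‖F (hT.laplace hr w)‖ₑ ≤
      ∫⁻ u in Ioi 0, ENNReal.ofReal (Real.exp (-r * u)) * ‖F (T.op u w)‖ₑ := by
  refine (enorm_map_integral_le F (hT.integrableOn_exp_smul_op hr w)).trans_eq
    (lintegral_congr fun u => ?_)
  rw [ContinuousLinearMap.map_smul_of_tower, enorm_smul, Real.enorm_of_nonneg (Real.exp_nonneg _)]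

theorem IsBounded.enorm_map_laplace_le_outputNorm (hT : T.IsBounded) (hr : 0 < r)
    (F : X →L[ℂ] Y) (w : X) :
    ‖F (hT.laplace hr w)‖ₑ ≤ ENNReal.ofReal (r ^ (-(1 / 2) : ℝ)) * T.outputNorm F w := by
  rw [← ENNReal.pow_le_pow_left_iff two_ne_zero]
  have hF := (T.continuous_map_op_apply F w).enorm.measurable
  calc ‖F (hT.laplace hr w)‖ₑ ^ 2
      ≤ (∫⁻ u in Ioi 0, ENNReal.ofReal (Real.exp (-r * u)) * ‖F (T.op u w)‖ₑ) ^ 2 := by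
        gcongr
        exact hT.enorm_map_laplace_le hr F w
    _ ≤ (∫⁻ u in Ioi 0, ENNReal.ofReal (Real.exp (-r * u))) *
          ∫⁻ u in Ioi 0, ENNReal.ofReal (Real.exp (-r * u)) * ‖F (T.op u w)‖ₑ ^ 2 :=
        sq_lintegral_mul_le (by fun_prop) hF.aemeasurable
    _ ≤ ENNReal.ofReal r⁻¹ * T.outputNorm F w ^ 2 := by
        rw [lintegral_ofReal_exp_neg_mul_Ioi hr, sq_outputNorm]
        gcongr _ * ?_
        refine setLIntegral_mono' measurableSet_Ioi fun u (hu : 0 < u) => mul_le_of_le_one_left' ?_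
        rw [ENNReal.ofReal_le_one, Real.exp_le_one_iff, neg_mul, neg_nonpos]
        positivity
    _ = (ENNReal.ofReal (r ^ (-(1 / 2) : ℝ)) * T.outputNorm F w) ^ 2 := by
        rw [mul_pow, ← ENNReal.ofReal_pow (by positivity), ← Real.rpow_natCast,
          ← Real.rpow_mul hr.le, ← Real.rpow_neg_one]
        norm_num

theorem IsBounded.outputNorm_laplace_le (hT : T.IsBounded) (hr : 0 < r) (F : X →L[ℂ] Y) (w : X) :
    T.outputNorm F (hT.laplace hr w) ≤ ENNReal.ofReal r⁻¹ * T.outputNorm F w := by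
  rw [← ENNReal.pow_le_pow_left_iff two_ne_zero, mul_pow, sq_outputNorm, sq_outputNorm,
    ← lintegral_ofReal_exp_neg_mul_Ioi hr]
  refine (setLIntegral_mono' measurableSet_Ioi fun t (ht : 0 < t) => ?_).trans
    (lintegral_sq_lintegral_mul_comp_add_le (by fun_prop)
      (T.continuous_map_op_apply F w).enorm.measurable)
  rw [← mul_apply_eq_comp, (hT.commute_op_laplace hr t).eq, mul_apply_eq_comp]
  gcongr
  refine (hT.enorm_map_laplace_le hr F _).trans_eq
    (setLIntegral_congr_fun measurableSet_Ioi fun u (hu : 0 < u) => ?_)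
  simp only [T.op_op hu.le ht.le, add_comm u t]

namespace IsGenerator

variable {A : X →ₗ.[ℂ] X}

theorem enorm_map_shiftInverse_le (hA : T.IsGenerator (-A)) (hT : T.IsBounded) (hr : 0 < r)
    (F : X →L[ℂ] Y) (w : X) :
    ‖F (shiftInverse A r w)‖ₑ ≤ ENNReal.ofReal (r ^ (-(1 / 2) : ℝ)) * T.outputNorm F w :=
  hA.shiftInverse_eq_laplace hT hr ▸ hT.enorm_map_laplace_le_outputNorm hr F w

theorem outputNorm_shiftInverse_one_pow_le (hA : T.IsGenerator (-A)) (hT : T.IsBounded)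
    (F : X →L[ℂ] Y) (w : X) (k : ℕ) :
    T.outputNorm F ((shiftInverse A 1 ^ k) w) ≤ T.outputNorm F w := by
  induction k with
  | zero => rfl
  | succ k ih =>
    rw [pow_succ', mul_apply_eq_comp, hA.shiftInverse_eq_laplace hT one_pos]
    rw [hA.shiftInverse_eq_laplace hT one_pos] at ih
    refine (hT.outputNorm_laplace_le one_pos F _).trans ?_
    rwa [inv_one, ENNReal.ofReal_one, one_mul]

theorem outputNorm_yosida_le (hA : T.IsGenerator (-A)) (hT : T.IsBounded) (F : X →L[ℂ] Y)
    (w : X) : T.outputNorm F (yosida A w) ≤ 2 * T.outputNorm F w := by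
  rw [two_mul]
  refine (T.outputNorm_sub_le F w (shiftInverse A 1 w)).trans (add_le_add_right ?_ _)
  simpa only [pow_one] using hA.outputNorm_shiftInverse_one_pow_le hT F w 1

theorem shiftInverse_yosida (hA : T.IsGenerator (-A)) (hT : T.IsBounded) (hr : 0 < r) (w : X) :
    shiftInverse A r (yosida A w) =
      shiftInverse A 1 w - r • shiftInverse A r (shiftInverse A 1 w) := by
  have h := DFunLike.congr_fun ((hA.isBoundedInverse_shiftInverse hT hr).sub_eq_smul_mul
    (hA.isBoundedInverse_shiftInverse hT one_pos)) w
  simp only [sub_apply, smul_apply, mul_apply_eq_comp] at h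
  simp only [yosida, sub_apply, one_apply_eq_self, map_sub]
  rw [sub_eq_iff_eq_add.1 h]
  module

theorem enorm_map_shiftInverse_one_le (hA : T.IsGenerator (-A)) (hT : T.IsBounded)
    (F : X →L[ℂ] Y) (w : X) : ‖F (shiftInverse A 1 w)‖ₑ ≤ T.outputNorm F w := by
  simpa only [Real.one_rpow, ENNReal.ofReal_one, one_mul] using
    hA.enorm_map_shiftInverse_le hT one_pos F w

theorem enorm_map_yosida_shiftInverse_one_le (hA : T.IsGenerator (-A)) (hT : T.IsBounded)
    (F : X →L[ℂ] Y) (w : X) :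
    ‖F (yosida A (shiftInverse A 1 w))‖ₑ ≤ 2 * T.outputNorm F w := by
  rw [← mul_apply_eq_comp, (commute_yosida_shiftInverse_one A).eq, mul_apply_eq_comp]
  exact (hA.enorm_map_shiftInverse_one_le hT F _).trans (hA.outputNorm_yosida_le hT F w)

theorem enorm_map_shiftInverse_yosida_le_rpow_mul (hA : T.IsGenerator (-A)) (hT : T.IsBounded)
    (hr : 0 < r) (F : X →L[ℂ] Y) (w : X) :
    ‖F (shiftInverse A r (yosida A w))‖ₑ ≤
      ENNReal.ofReal (r ^ (-(1 / 2) : ℝ)) * (2 * T.outputNorm F w) :=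
  (hA.enorm_map_shiftInverse_le hT hr F _).trans
    (mul_le_mul_right (hA.outputNorm_yosida_le hT F w) _)

theorem enorm_map_shiftInverse_yosida_le (hA : T.IsGenerator (-A)) (hT : T.IsBounded)
    (hr : 0 < r) (F : X →L[ℂ] Y) (w : X) :
    ‖F (shiftInverse A r (yosida A w))‖ₑ ≤ 2 * T.outputNorm F w := by
  rcases le_total r 1 with hr1 | hr1
  · have hrpow : ENNReal.ofReal r * ENNReal.ofReal (r ^ (-(1 / 2) : ℝ)) ≤ 1 := by
      rw [← ENNReal.ofReal_mul hr.le, ← Real.rpow_one_add' hr.le (by norm_num),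
        ENNReal.ofReal_le_one]
      exact Real.rpow_le_one hr.le hr1 (by norm_num)
    have hsmul : ‖F (r • shiftInverse A r (shiftInverse A 1 w))‖ₑ ≤ T.outputNorm F w :=
      calc ‖F (r • shiftInverse A r (shiftInverse A 1 w))‖ₑ
          ≤ ENNReal.ofReal r * (ENNReal.ofReal (r ^ (-(1 / 2) : ℝ)) *
              T.outputNorm F (shiftInverse A 1 w)) := by
            rw [ContinuousLinearMap.map_smul_of_tower, enorm_smul, Real.enorm_of_nonneg hr.le]
            gcongr
            exact hA.enorm_map_shiftInverse_le hT hr F _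
        _ ≤ T.outputNorm F (shiftInverse A 1 w) := by
            rw [← mul_assoc]
            exact mul_le_of_le_one_left' hrpow
        _ ≤ T.outputNorm F w := by
            simpa only [pow_one] using hA.outputNorm_shiftInverse_one_pow_le hT F w 1
    rw [hA.shiftInverse_yosida hT hr, map_sub, two_mul]
    exact enorm_sub_le.trans (add_le_add (hA.enorm_map_shiftInverse_one_le hT F w) hsmul)
  · refine (hA.enorm_map_shiftInverse_yosida_le_rpow_mul hT hr F w).trans
      (mul_le_of_le_one_left' ?_)
    rw [ENNReal.ofReal_le_one]
    exact Real.rpow_le_one_of_one_le_of_nonpos hr1 (by norm_num)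

theorem enorm_map_shiftInverse_shiftInverse_one_le (hA : T.IsGenerator (-A)) (hT : T.IsBounded)
    (hr : 0 < r) (F : X →L[ℂ] Y) (w : X) :
    ‖F (shiftInverse A r (shiftInverse A 1 w))‖ₑ ≤
      ENNReal.ofReal r⁻¹ * (3 * T.outputNorm F w) := by
  have hsmul : shiftInverse A r (shiftInverse A 1 w) =
      r⁻¹ • (shiftInverse A 1 w - shiftInverse A r (yosida A w)) := by
    rw [hA.shiftInverse_yosida hT hr, sub_sub_cancel, inv_smul_smul₀ hr.ne']
  rw [hsmul, ContinuousLinearMap.map_smul_of_tower, enorm_smul,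
    Real.enorm_of_nonneg (inv_nonneg.2 hr.le), map_sub, ← two_add_one_eq_three, add_mul, one_mul,
    add_comm]
  gcongr
  exact enorm_sub_le.trans (add_le_add (hA.enorm_map_shiftInverse_one_le hT F w)
    (hA.enorm_map_shiftInverse_yosida_le hT hr F w))

theorem enorm_map_shiftInverse_yosida_shiftInverse_one_le (hA : T.IsGenerator (-A))
    (hT : T.IsBounded) (hr : 0 < r) (F : X →L[ℂ] Y) (w : X) :
    ‖F (shiftInverse A r (yosida A (shiftInverse A 1 w)))‖ₑ ≤
      ENNReal.ofReal r⁻¹ * (6 * T.outputNorm F w) := by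
  have hsix : (6 : ℝ≥0∞) = 3 * 2 := by norm_num
  rw [← mul_apply_eq_comp (yosida A), (commute_yosida_shiftInverse_one A).eq, mul_apply_eq_comp,
    hsix, mul_assoc]
  exact (hA.enorm_map_shiftInverse_shiftInverse_one_le hT hr F _).trans (by
    gcongr
    exact hA.outputNorm_yosida_le hT F w)

end IsGenerator

end Output

end C0Semigroup

section FractionalPower

variable {X Y : Type*} [NormedAddCommGroup X] [NormedSpace ℂ X] [CompleteSpace X]
  [NormedAddCommGroup Y] [NormedSpace ℂ Y] [CompleteSpace Y] {T : C0Semigroup X}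
  {A : X →ₗ.[ℂ] X} {r s α : ℝ} {S : X →L[ℂ] X}

theorem abs_sin_pi_mul_div_pi_le_one (s : ℝ) : |Real.sin (Real.pi * s) / Real.pi| ≤ 1 := by
  rw [abs_div, abs_of_pos Real.pi_pos, div_le_one Real.pi_pos]
  exact (Real.abs_sin_le_one _).trans (by linarith [Real.two_le_pi])

theorem enorm_map_balakrishnan_le (F : X →L[ℂ] Y) {z : X}
    (hz : IntegrableOn (fun r : ℝ => r ^ (-s) • shiftInverse A r z) (Ioi 0)) :
    ‖F (balakrishnan A s z)‖ₑ ≤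
      ∫⁻ r in Ioi 0, ENNReal.ofReal (r ^ (-s)) * ‖F (shiftInverse A r z)‖ₑ := by
  have hconst : ‖Real.sin (Real.pi * s) / Real.pi‖ₑ ≤ 1 := by
    rw [← ofReal_norm, ENNReal.ofReal_le_one]
    exact abs_sin_pi_mul_div_pi_le_one s
  rw [balakrishnan, ContinuousLinearMap.map_smul_of_tower, enorm_smul]
  refine (mul_le_of_le_one_left' hconst).trans ((enorm_map_integral_le F hz).trans_eq
    (setLIntegral_congr_fun measurableSet_Ioi fun r (hr : 0 < r) => ?_))
  simp only [ContinuousLinearMap.map_smul_of_tower, enorm_smul,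
    Real.enorm_of_nonneg (Real.rpow_nonneg hr.le _)]

theorem balakrishnan_apply_of_commute (hS : ∀ r > 0, Commute S (shiftInverse A r)) {z : X}
    (hz : IntegrableOn (fun r : ℝ => r ^ (-s) • shiftInverse A r z) (Ioi 0)) :
    balakrishnan A s (S z) = S (balakrishnan A s z) := by
  rw [balakrishnan, balakrishnan, ContinuousLinearMap.map_smul_of_tower,
    ← S.integral_comp_comm hz]
  congr 1
  refine setIntegral_congr_fun measurableSet_Ioi fun r hr => ?_
  simp only [ContinuousLinearMap.map_smul_of_tower, ← mul_apply_eq_comp, (hS r hr).eq]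

namespace C0Semigroup.IsGenerator

theorem exists_norm_shiftInverse_le (hA : T.IsGenerator (-A)) (hT : T.IsBounded)
    (hinv : IsBoundedlyInvertible A) :
    ∃ c : ℝ, ∀ r > 0, ‖shiftInverse A r‖ ≤ c ∧ ‖shiftInverse A r‖ ≤ r ^ (-1 : ℝ) * c := by
  obtain ⟨M, hM⟩ := hT
  refine ⟨max (‖boundedInverse A‖ * (1 + M)) M, fun r hr => ?_⟩
  have hdecay : ‖shiftInverse A r‖ ≤ M / r :=
    hA.shiftInverse_eq_laplace ⟨M, hM⟩ hr ▸ IsBounded.norm_laplace_le ⟨M, hM⟩ hM hr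
  have hresolvent : shiftInverse A r =
      boundedInverse A - boundedInverse A * r • shiftInverse A r := by
    have h := hinv.isBoundedInverse_shift_zero.sub_eq_smul_mul
      (hA.isBoundedInverse_shiftInverse ⟨M, hM⟩ hr)
    rw [sub_zero, ← mul_smul_comm] at h
    rw [← h, sub_sub_cancel]
  constructor
  · refine le_max_of_le_left ?_
    have hsmul : ‖r • shiftInverse A r‖ ≤ M := by
      rw [norm_smul, Real.norm_of_nonneg hr.le, ← le_div_iff₀' hr]
      exact hdecay
    calc ‖shiftInverse A r‖
        = ‖boundedInverse A - boundedInverse A * r • shiftInverse A r‖ :=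
          congrArg _ hresolvent
      _ ≤ ‖boundedInverse A‖ + ‖boundedInverse A‖ * M :=
          (norm_sub_le _ _).trans (by gcongr; exact (norm_mul_le _ _).trans (by gcongr))
      _ = ‖boundedInverse A‖ * (1 + M) := by ring
  · rw [Real.rpow_neg_one, ← div_eq_inv_mul]
    exact hdecay.trans (by gcongr; exact le_max_right _ _)

theorem aestronglyMeasurable_shiftInverse_apply (hA : T.IsGenerator (-A)) (hT : T.IsBounded)
    (z : X) : AEStronglyMeasurable (fun r => shiftInverse A r z) (volume.restrict (Ioi 0)) := by
  have hlaplace := ((T.continuous_exp_smul_op z).stronglyMeasurable.integral_prod_right'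
    (ν := volume.restrict (Ioi 0))).aestronglyMeasurable (μ := volume.restrict (Ioi (0 : ℝ)))
  refine hlaplace.congr ((ae_restrict_mem measurableSet_Ioi).mono fun r hr => ?_)
  exact (DFunLike.congr_fun (hA.shiftInverse_eq_laplace hT hr) z).symm

theorem integrableOn_rpow_smul_shiftInverse (hA : T.IsGenerator (-A)) (hT : T.IsBounded)
    (hinv : IsBoundedlyInvertible A) (hs0 : 0 < s) (hs1 : s < 1) (z : X) :
    IntegrableOn (fun r : ℝ => r ^ (-s) • shiftInverse A r z) (Ioi 0) := by
  obtain ⟨c, hc⟩ := hA.exists_norm_shiftInverse_le hT hinv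
  obtain ⟨K, hK⟩ := exists_lintegral_rpow_mul_le (β := 1) hs1 (by linarith)
  have hbound : ∀ r > 0, ‖shiftInverse A r z‖ₑ ≤ ENNReal.ofReal (c * ‖z‖) := fun r hr => by
    rw [← ofReal_norm]
    exact ENNReal.ofReal_le_ofReal ((shiftInverse A r).le_of_opNorm_le (hc r hr).1 z)
  have hdecay : ∀ r > 0, ‖shiftInverse A r z‖ₑ ≤
      ENNReal.ofReal (r ^ (-1 : ℝ)) * ENNReal.ofReal (c * ‖z‖) := fun r (hr : 0 < r) => by
    rw [← ofReal_norm, ← ENNReal.ofReal_mul (by positivity), ← mul_assoc]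
    exact ENNReal.ofReal_le_ofReal ((shiftInverse A r).le_of_opNorm_le (hc r hr).2 z)
  refine ⟨(by fun_prop : Measurable fun r : ℝ => r ^ (-s)).aestronglyMeasurable.smul
    (hA.aestronglyMeasurable_shiftInverse_apply hT z), ?_⟩
  rw [hasFiniteIntegral_iff_enorm]
  refine lt_of_le_of_lt ?_ (ENNReal.mul_lt_top (ENNReal.coe_lt_top (r := K))
    (ENNReal.ofReal_lt_top (r := c * ‖z‖)))
  refine (setLIntegral_congr_fun measurableSet_Ioi fun r (hr : 0 < r) => ?_).trans_le
    (hK _ _ hbound hdecay)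
  simp only [enorm_smul, Real.enorm_of_nonneg (Real.rpow_nonneg hr.le _)]

theorem exists_enorm_map_balakrishnan_yosida_le (hA : T.IsGenerator (-A)) (hT : T.IsBounded)
    (hinv : IsBoundedlyInvertible A) (hs : 1 / 2 < s) (hs1 : s < 1) (F : X →L[ℂ] Y) :
    ∃ K : ℝ≥0, ∀ w, ‖F (balakrishnan A s (yosida A w))‖ₑ ≤ K * T.outputNorm F w := by
  obtain ⟨K, hK⟩ := exists_lintegral_rpow_mul_le (β := 1 / 2) hs1 (by linarith)
  refine ⟨K * 2, fun w => ?_⟩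
  rw [ENNReal.coe_mul, mul_assoc]
  exact (enorm_map_balakrishnan_le F
    (hA.integrableOn_rpow_smul_shiftInverse hT hinv (by linarith) hs1 _)).trans
    (hK _ _ (fun r hr => hA.enorm_map_shiftInverse_yosida_le hT hr F w)
      fun r hr => hA.enorm_map_shiftInverse_yosida_le_rpow_mul hT hr F w)

theorem exists_enorm_map_balakrishnan_yosida_shiftInverse_one_le (hA : T.IsGenerator (-A))
    (hT : T.IsBounded) (hinv : IsBoundedlyInvertible A) (hs0 : 0 < s) (hs1 : s < 1)
    (F : X →L[ℂ] Y) :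
    ∃ K : ℝ≥0, ∀ w,
      ‖F (balakrishnan A s (yosida A (shiftInverse A 1 w)))‖ₑ ≤ K * T.outputNorm F w := by
  obtain ⟨K, hK⟩ := exists_lintegral_rpow_mul_le (β := 1) hs1 (by linarith)
  refine ⟨K * 6, fun w => ?_⟩
  have hbound : ∀ r > 0, ‖F (shiftInverse A r (yosida A (shiftInverse A 1 w)))‖ₑ ≤
      6 * T.outputNorm F w := fun r hr => by
    refine (hA.enorm_map_shiftInverse_yosida_le hT hr F _).trans ?_
    gcongr
    · norm_num
    · simpa only [pow_one] using hA.outputNorm_shiftInverse_one_pow_le hT F w 1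
  rw [ENNReal.coe_mul, mul_assoc]
  refine (enorm_map_balakrishnan_le F
    (hA.integrableOn_rpow_smul_shiftInverse hT hinv hs0 hs1 _)).trans
    (hK _ _ hbound fun r hr => ?_)
  rw [Real.rpow_neg_one]
  exact hA.enorm_map_shiftInverse_yosida_shiftInverse_one_le hT hr F w

theorem negPow_apply_of_commute (hA : T.IsGenerator (-A)) (hT : T.IsBounded)
    (hinv : IsBoundedlyInvertible A) (hS : Commute S (boundedInverse A)) (α : ℝ) (z : X) :
    negPow A α (S z) = S (negPow A α z) := by
  have hpow := (hS.pow_right ⌊α⌋₊).eq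
  have hresolvent : ∀ r > 0, Commute S (shiftInverse A r) := fun r hr =>
    ((hA.isBoundedInverse_shiftInverse hT hr).commute_iff_map_mem_graph.2
      (hinv.isBoundedInverse_shift_zero.commute_iff_map_mem_graph.1 hS.symm)).symm
  rcases (Int.fract_nonneg α).eq_or_lt' with hα | hα
  · rw [negPow, negPow, if_pos hα, if_pos hα, ← mul_apply_eq_comp, ← hpow, mul_apply_eq_comp]
  · rw [negPow, negPow, if_neg hα.ne', if_neg hα.ne', balakrishnan_apply_of_commute hresolvent
      (hA.integrableOn_rpow_smul_shiftInverse hT hinv hα (Int.fract_lt_one α) z),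
      ← mul_apply_eq_comp, ← hpow, mul_apply_eq_comp]

theorem negPow_mem_graph (hA : T.IsGenerator (-A)) (hT : T.IsBounded)
    (hinv : IsBoundedlyInvertible A) (α : ℝ) {x y : X} (hxy : (x, y) ∈ A.graph) :
    (negPow A α x, negPow A α y) ∈ A.graph := by
  rw [hinv.isBoundedInverse.mem_graph_iff] at hxy ⊢
  rw [← hA.negPow_apply_of_commute hT hinv (Commute.refl _), hxy]

theorem commute_boundedInverse_shiftInverse (hA : T.IsGenerator (-A)) (hT : T.IsBounded)
    (hinv : IsBoundedlyInvertible A) (hr : 0 < r) :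
    Commute (boundedInverse A) (shiftInverse A r) :=
  hinv.isBoundedInverse_shift_zero.commute (hA.isBoundedInverse_shiftInverse hT hr)

theorem boundedInverse_sub_shiftInverse_one (hA : T.IsGenerator (-A)) (hT : T.IsBounded)
    (hinv : IsBoundedlyInvertible A) :
    boundedInverse A - shiftInverse A 1 = boundedInverse A * shiftInverse A 1 := by
  rw [hinv.isBoundedInverse_shift_zero.sub_eq_smul_mul
    (hA.isBoundedInverse_shiftInverse hT one_pos), sub_zero, one_smul]

theorem commute_boundedInverse_yosida (hA : T.IsGenerator (-A)) (hT : T.IsBounded)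
    (hinv : IsBoundedlyInvertible A) : Commute (boundedInverse A) (yosida A) :=
  (Commute.one_right _).sub_right (hA.commute_boundedInverse_shiftInverse hT hinv one_pos)

theorem boundedInverse_pow_mul_yosida_pow_succ (hA : T.IsGenerator (-A)) (hT : T.IsBounded)
    (hinv : IsBoundedlyInvertible A) (k : ℕ) :
    boundedInverse A ^ k * yosida A ^ (k + 1) = yosida A * shiftInverse A 1 ^ k :=
  pow_mul_one_sub_pow_succ_of_sub_eq_mul (hA.boundedInverse_sub_shiftInverse_one hT hinv)
    (hA.commute_boundedInverse_shiftInverse hT hinv one_pos) k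

theorem exists_enorm_le_mul_enorm_yosida_pow (hA : T.IsGenerator (-A)) (hT : T.IsBounded)
    (hinv : IsBoundedlyInvertible A) (n : ℕ) :
    ∃ L : ℝ≥0, ∀ x, ‖x‖ₑ ≤ L * ‖(yosida A ^ n) x‖ₑ := by
  have hinverse : (1 + boundedInverse A) ^ n * yosida A ^ n = 1 := pow_mul_pow_eq_one n
    (one_add_mul_one_sub_of_sub_eq_mul (hA.boundedInverse_sub_shiftInverse_one hT hinv))
  refine ⟨‖(1 + boundedInverse A) ^ n‖₊, fun x => ?_⟩
  calc ‖x‖ₑ = ‖((1 + boundedInverse A) ^ n) ((yosida A ^ n) x)‖ₑ := by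
        rw [← mul_apply_eq_comp, hinverse, one_apply_eq_self]
    _ ≤ ‖(1 + boundedInverse A) ^ n‖ₑ * ‖(yosida A ^ n) x‖ₑ :=
        ContinuousLinearMap.le_opENorm _ _

theorem yosida_pow_mem_graph (hA : T.IsGenerator (-A)) (hT : T.IsBounded)
    (hinv : IsBoundedlyInvertible A) (n : ℕ) {x y : X} (hxy : (x, y) ∈ A.graph) :
    ((yosida A ^ n) x, (yosida A ^ n) y) ∈ A.graph :=
  hinv.isBoundedInverse_shift_zero.commute_iff_map_mem_graph.1
    ((hA.commute_boundedInverse_yosida hT hinv).pow_right n) _ _ hxy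

theorem negPow_yosida_pow_of_fract_eq_zero (hA : T.IsGenerator (-A)) (hT : T.IsBounded)
    (hinv : IsBoundedlyInvertible A) (hα : Int.fract α = 0) (w : X) :
    negPow A α ((yosida A ^ (⌊α⌋₊ + 1)) w) = yosida A ((shiftInverse A 1 ^ ⌊α⌋₊) w) := by
  rw [negPow, if_pos hα, ← mul_apply_eq_comp, ← mul_apply_eq_comp,
    hA.boundedInverse_pow_mul_yosida_pow_succ hT hinv]

theorem negPow_yosida_pow_of_fract_ne_zero (hA : T.IsGenerator (-A)) (hT : T.IsBounded)
    (hinv : IsBoundedlyInvertible A) (hα : Int.fract α ≠ 0) (w : X) :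
    negPow A α ((yosida A ^ (⌊α⌋₊ + 1)) w) =
      balakrishnan A (Int.fract α) (yosida A ((shiftInverse A 1 ^ ⌊α⌋₊) w)) := by
  rw [negPow, if_neg hα, ← balakrishnan_apply_of_commute
    (fun r hr => (hA.commute_boundedInverse_shiftInverse hT hinv hr).pow_left _)
    (hA.integrableOn_rpow_smul_shiftInverse hT hinv ((Int.fract_nonneg α).lt_of_ne' hα)
      (Int.fract_lt_one α) _),
    ← mul_apply_eq_comp, ← mul_apply_eq_comp, hA.boundedInverse_pow_mul_yosida_pow_succ hT hinv]

theorem exists_enorm_map_negPow_yosida_pow_le (hA : T.IsGenerator (-A)) (hT : T.IsBounded)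
    (hinv : IsBoundedlyInvertible A) (hα : 1 / 2 < α) (F : X →L[ℂ] Y) :
    ∃ K : ℝ≥0, ∀ w,
      ‖F (negPow A α ((yosida A ^ (⌊α⌋₊ + 1)) w))‖ₑ ≤ K * T.outputNorm F w := by
  rcases hk : ⌊α⌋₊ with _ | j
  · have hfract : Int.fract α = α := Int.fract_eq_self.2
      ⟨by linarith, (Nat.floor_eq_zero.1 hk)⟩
    have hbalakrishnan := hA.negPow_yosida_pow_of_fract_ne_zero hT hinv
      (α := α) (by rw [hfract]; linarith)
    simp only [hk, hfract, pow_zero, one_apply_eq_self] at hbalakrishnan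
    simp only [hbalakrishnan]
    exact hA.exists_enorm_map_balakrishnan_yosida_le hT hinv hα (Nat.floor_eq_zero.1 hk) F
  · suffices h : ∃ K : ℝ≥0, ∀ w,
        ‖F (negPow A α ((yosida A ^ (⌊α⌋₊ + 1)) w))‖ₑ ≤
          K * T.outputNorm F ((shiftInverse A 1 ^ j) w) by
      obtain ⟨K, hK⟩ := h
      exact ⟨K, fun w => hk ▸ (hK w).trans
        (mul_le_mul_right (hA.outputNorm_shiftInverse_one_pow_le hT F w j) _)⟩
    by_cases hfract : Int.fract α = 0
    · refine ⟨2, fun w => ?_⟩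
      rw [hA.negPow_yosida_pow_of_fract_eq_zero hT hinv hfract, hk, pow_succ', mul_apply_eq_comp]
      exact hA.enorm_map_yosida_shiftInverse_one_le hT F _
    · obtain ⟨K, hK⟩ := hA.exists_enorm_map_balakrishnan_yosida_shiftInverse_one_le hT hinv
        ((Int.fract_nonneg α).lt_of_ne' hfract) (Int.fract_lt_one α) F
      refine ⟨K, fun w => ?_⟩
      rw [hA.negPow_yosida_pow_of_fract_ne_zero hT hinv hfract, hk, pow_succ', mul_apply_eq_comp]
      exact hK _

end C0Semigroup.IsGenerator

end FractionalPower

section Observability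

variable {X Y : Type*} [NormedAddCommGroup X] [NormedSpace ℂ X] [NormedAddCommGroup Y]
  [NormedSpace ℂ Y] {T : C0Semigroup X} {A : X →ₗ.[ℂ] X}

theorem IsGraphBounded.exists_map_eq {C : A.domain →ₗ[ℂ] Y} (hC : IsGraphBounded A C)
    (hinv : IsBoundedlyInvertible A) : ∃ F : X →L[ℂ] Y, ∀ x : A.domain, F (A x) = C x := by
  obtain ⟨R, hR⟩ := hinv
  obtain ⟨K, hK⟩ := hC
  have hdom : ∀ y, R y ∈ A.domain := fun y => (hR.2 y).1
  have hright : ∀ y, A ⟨R y, hdom y⟩ = y := fun y => (hR.2 y).2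
  let F : X →ₗ[ℂ] Y := C ∘ₗ (R : X →ₗ[ℂ] X).codRestrict A.domain hdom
  refine ⟨F.mkContinuousOfExistsBound ⟨|K| * (‖R‖ + 1), fun y => ?_⟩, fun x => ?_⟩
  · calc ‖C ⟨R y, hdom y⟩‖
        ≤ K * (‖R y‖ + ‖A ⟨R y, hdom y⟩‖) := hK _
      _ ≤ |K| * (‖R‖ * ‖y‖ + ‖y‖) := by
          rw [hright]
          gcongr
          · exact le_abs_self K
          · exact R.le_opNorm y
      _ = |K| * (‖R‖ + 1) * ‖y‖ := by ring
  · exact congrArg C (Subtype.ext (hR.1 x))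

theorem C0Semigroup.IsGenerator.apply_onDomain (hA : T.IsGenerator (-A)) (t : ℝ≥0)
    (x : A.domain) : A (C0Semigroup.onDomain hA t x) = T.toFun t (A x) := by
  have hcomm : ∀ s, Commute (T.toFun t) (T.toFun s) := fun s =>
    T.op_coe t ▸ T.op_coe s ▸ T.commute_op t s
  have hgraph : (T.toFun t x, T.toFun t (-A x)) ∈ (-A).graph :=
    hA.map_mem_graph hcomm ((-A).mem_graph x)
  rw [mem_graph_neg_iff, map_neg, neg_neg] at hgraph
  exact ((LinearPMap.image_iff (C0Semigroup.onDomain hA t x).2).2 hgraph).symm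

theorem enorm_le_of_le_norm_apply {C : A.domain →ₗ[ℂ] Y} {F : X →L[ℂ] Y}
    (hF : ∀ x : A.domain, F (A x) = C x) {δ : ℝ} (hδ : 0 < δ) {p : X → X}
    (hp : ∀ {x y}, (x, y) ∈ A.graph → (p x, p y) ∈ A.graph)
    (hlow : ∀ (x : A.domain) (h : p x ∈ A.domain), δ * ‖(x : X)‖ ≤ ‖C ⟨p x, h⟩‖)
    {x y : X} (hxy : (x, y) ∈ A.graph) :
    ‖x‖ₑ ≤ ENNReal.ofReal δ⁻¹ * ‖F (p y)‖ₑ := by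
  have hpx : p x ∈ A.domain := LinearPMap.mem_domain_of_mem_graph (hp hxy)
  have h := hlow ⟨x, LinearPMap.mem_domain_of_mem_graph hxy⟩ hpx
  rw [← hF, ← (LinearPMap.image_iff hpx).2 (hp hxy), ← le_inv_mul_iff₀ hδ] at h
  rw [← ofReal_norm, ← ofReal_norm, ← ENNReal.ofReal_mul (by positivity)]
  exact ENNReal.ofReal_le_ofReal h

theorem isInfiniteTimeExactlyObservable_of_enorm_le (hA : T.IsGenerator (-A))
    {C : A.domain →ₗ[ℂ] Y} {F : X →L[ℂ] Y} (hF : ∀ x : A.domain, F (A x) = C x) {K : ℝ≥0}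
    (hK : ∀ x : A.domain, ‖(x : X)‖ₑ ≤ K * T.outputNorm F (A x)) :
    IsInfiniteTimeExactlyObservable hA C := by
  refine ⟨(K + 1 : ℝ≥0)⁻¹, by positivity, fun x => ?_⟩
  have hoperator : ∀ t, C (C0Semigroup.onDomain hA t.toNNReal x) = F (T.op t (A x)) := fun t => by
    rw [← hF, hA.apply_onDomain, C0Semigroup.op]
  have hx : ‖(x : X)‖ₑ ≤ (K + 1 : ℝ≥0) * T.outputNorm F (A x) :=
    (hK x).trans (by gcongr; exact le_self_add)
  simp only [hoperator, ← T.sq_outputNorm]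
  rw [← mul_pow, ENNReal.ofReal_pow (by positivity), ENNReal.ofReal_mul (by positivity),
    ofReal_norm, ← NNReal.coe_inv, ENNReal.ofReal_coe_nnreal, ENNReal.coe_inv (by positivity),
    ← ENNReal.div_eq_inv_mul]
  gcongr
  exact ENNReal.div_le_of_le_mul' hx

end Observability

theorem mainTheorem10 {X Y : Type*} [NormedAddCommGroup X] [NormedSpace ℂ X] [CompleteSpace X]
    [NormedAddCommGroup Y] [NormedSpace ℂ Y] [CompleteSpace Y]
    (T : C0Semigroup X) (hT : T.IsBounded)
    (A : X →ₗ.[ℂ] X) (hA : T.IsGenerator (-A)) (hinv : IsBoundedlyInvertible A)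
    (C : A.domain →ₗ[ℂ] Y) (hC : IsGraphBounded A C)
    (ε δ : ℝ) (hε : 0 < ε) (hδ : 0 < δ)
    (hlow : ∀ (x : A.domain) (h : negPow A (1 / 2 + ε) x ∈ A.domain),
      δ * ‖(x : X)‖ ≤ ‖C ⟨negPow A (1 / 2 + ε) x, h⟩‖) :
    IsInfiniteTimeExactlyObservable hA C := by
  obtain ⟨F, hF⟩ := hC.exists_map_eq hinv
  obtain ⟨K, hK⟩ := hA.exists_enorm_map_negPow_yosida_pow_le hT hinv
    (show 1 / 2 < 1 / 2 + ε by linarith) F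
  obtain ⟨L, hL⟩ := hA.exists_enorm_le_mul_enorm_yosida_pow hT hinv (⌊1 / 2 + ε⌋₊ + 1)
  refine isInfiniteTimeExactlyObservable_of_enorm_le hA hF
    (K := L * (δ⁻¹.toNNReal * K)) fun x => ?_
  have hQ := hA.yosida_pow_mem_graph hT hinv (⌊1 / 2 + ε⌋₊ + 1) (A.mem_graph x)
  rw [ENNReal.coe_mul, ENNReal.coe_mul, mul_assoc, mul_assoc]
  refine (hL x).trans (mul_le_mul_right ?_ _)
  exact (enorm_le_of_le_norm_apply hF hδ (hA.negPow_mem_graph hT hinv _) hlow hQ).trans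
    (mul_le_mul_right (hK _) _)
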